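/- Let $H^n$ be real hyperbolic space of dimension $n$. A convex polyhedron in $H^n$ is a set with nonempty interior that is the intersection of a locally finite (possibly infinite) family of closed half-spaces; its walls are its codimension-one faces, and two walls meet if they have a common point in $H^n$. A Coxeter polyhedron is a convex polyhedron all of whose dihedral angles (the interior angles between distinct walls that meet) are integral submultiples of $\pi$. A wall of a Coxeter polyhedron is a doubling wall if the angles it makes with the other walls that it meets are all of the form $\pi/(2k)$ with $k\ge 1$ an integer. A Coxeter polyhedron is redoublable if it has two doubling walls that do not meet each other in $H^n$. Let $W(Q)$ denote the group of isometries of $H^n$ generated by the reflections across the walls of the Coxeter polyhedron $Q$. Suppose $Q$ is a redoublable polyhedron in $H^n$ and $I$ is any positive integer. Then $W(Q)$ has a subgroup of index $I$ that is generated by reflections of $H^n$ across hyperplanes. -/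

import Mathlib

namespace HypCox

/-- The bilinear form of `ℝ^{n,1}`: `⟨x, y⟩ = -x₀ y₀ + x₁ y₁ + ⋯ + xₙ yₙ`. -/
def form {n : ℕ} (x y : Fin (n + 1) → ℝ) : ℝ :=
  -(x 0 * y 0) + ∑ i : Fin n, x i.succ * y i.succ

/-- Hyperbolic space `H^n` in the hyperboloid model: `⟨x, x⟩ = -1` and `x₀ > 0`,
with the topology it inherits from `ℝ^{n+1}`. -/
abbrev HypSpace (n : ℕ) : Type :=
  {x : Fin (n + 1) → ℝ // form x x = -1 ∧ 0 < x 0}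

/-- The vectors of norm `1` in `ℝ^{n,1}`.  Each of them is a unit normal vector of one hyperplane
of `H^n`, and `e`, `-e` are the two unit normal vectors of the same hyperplane. -/
abbrev UnitNormal (n : ℕ) : Type :=
  {e : Fin (n + 1) → ℝ // form e e = 1}

/-- The hyperplane `e^⊥ ∩ H^n`. -/
def hyperplane {n : ℕ} (e : UnitNormal n) : Set (HypSpace n) :=
  {x | form e.1 x.1 = 0}

/-- The closed half-space bounded by the hyperplane `e^⊥` for which `e` is the outward normal. -/
def halfSpace {n : ℕ} (e : UnitNormal n) : Set (HypSpace n) :=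
  {x | form e.1 x.1 ≤ 0}

theorem form_comm {n : ℕ} (x y : Fin (n + 1) → ℝ) : form x y = form y x := by
  simp only [form, mul_comm]

theorem form_sub_smul_right {n : ℕ} (x y z : Fin (n + 1) → ℝ) (a : ℝ) :
    form x (y - a • z) = form x y - a * form x z := by
  simp only [form, Pi.sub_apply, Pi.smul_apply, smul_eq_mul, mul_sub, Finset.sum_sub_distrib,
    mul_add, Finset.mul_sum]
  have h : ∀ i : Fin n, x i.succ * (a * z i.succ) = a * (x i.succ * z i.succ) := fun i => by ring
  simp only [h]
  ring

theorem form_sub_smul_left {n : ℕ} (x y z : Fin (n + 1) → ℝ) (a : ℝ) :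
    form (y - a • z) x = form y x - a * form z x := by
  rw [form_comm, form_sub_smul_right, form_comm x y, form_comm x z]

/-- Two vectors of norm `-1` with negative inner product lie in the same half of the light cone. -/
theorem pos_of_form_neg {n : ℕ} {x y : Fin (n + 1) → ℝ} (hx : form x x = -1) (hx0 : 0 < x 0)
    (hy : form y y = -1) (hxy : form x y < 0) : 0 < y 0 := by
  have hcs := Finset.sum_mul_sq_le_sq_mul_sq Finset.univ
    (fun i : Fin n => x i.succ) (fun i : Fin n => y i.succ)
  simp only [form] at hx hy hxy
  have hX : ∑ i : Fin n, x i.succ ^ 2 = x 0 ^ 2 - 1 := by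
    simp only [pow_two]; linarith
  have hY : ∑ i : Fin n, y i.succ ^ 2 = y 0 ^ 2 - 1 := by
    simp only [pow_two]; linarith
  have hY0 : 0 ≤ ∑ i : Fin n, y i.succ ^ 2 := Finset.sum_nonneg fun i _ => sq_nonneg _
  rw [hX, hY] at hcs
  rw [hY] at hY0
  by_contra hneg
  rw [not_lt] at hneg
  set S := ∑ i : Fin n, x i.succ * y i.succ with hS
  have h1 : 0 ≤ -(x 0 * y 0) := by nlinarith
  have h2 : (-(x 0 * y 0)) ^ 2 ≤ S ^ 2 := by
    apply sq_le_sq' <;> nlinarith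
  have hX0 : 0 ≤ ∑ i : Fin n, x i.succ ^ 2 := Finset.sum_nonneg fun i _ => sq_nonneg _
  rw [hX] at hX0
  nlinarith

/-- The map `x ↦ x - 2⟨e, x⟩e` preserves the hyperboloid sheet `H^n`. -/
theorem reflect_mem {n : ℕ} (e : UnitNormal n) (x : HypSpace n) :
    form (x.1 - (2 * form e.1 x.1) • e.1) (x.1 - (2 * form e.1 x.1) • e.1) = -1 ∧
      0 < (x.1 - (2 * form e.1 x.1) • e.1) 0 := by
  have h1 : form (x.1 - (2 * form e.1 x.1) • e.1) (x.1 - (2 * form e.1 x.1) • e.1) = -1 := by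
    rw [form_sub_smul_left, form_sub_smul_right, form_sub_smul_right, x.2.1, e.2,
      form_comm x.1 e.1]
    ring
  refine ⟨h1, pos_of_form_neg x.2.1 x.2.2 h1 ?_⟩
  rw [form_sub_smul_right, x.2.1, form_comm x.1 e.1]
  nlinarith [sq_nonneg (form e.1 x.1)]

/-- The reflection of `H^n` across the hyperplane `e^⊥`. -/
def reflection {n : ℕ} (e : UnitNormal n) : Equiv.Perm (HypSpace n) :=
  Function.Involutive.toPerm
    (fun x => ⟨x.1 - (2 * form e.1 x.1) • e.1, reflect_mem e x⟩)
    (by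
      intro x
      apply Subtype.ext
      simp only [form_sub_smul_right, e.2]
      funext i
      simp only [Pi.sub_apply, Pi.smul_apply, smul_eq_mul]
      ring)

/-- A permutation of `H^n` is a reflection if it is the reflection across some hyperplane. -/
def IsReflection {n : ℕ} (g : Equiv.Perm (HypSpace n)) : Prop :=
  ∃ e : UnitNormal n, g = reflection e

/-- A convex polyhedron in `H^n`, given by the outward unit normals of its walls.  It is the
intersection of the half-spaces `halfSpace e`, `e ∈ normals`; it has nonempty interior; the family
of bounding hyperplanes is locally finite (possibly infinite); and every bounding hyperplane
really carries a codimension-one face. -/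
structure ConvexPolyhedron (n : ℕ) where
  /-- The outward unit normals of the walls. -/
  normals : Set (UnitNormal n)
  locallyFinite : LocallyFinite fun e : normals => hyperplane e.1
  exists_interior : ∃ p : HypSpace n, ∀ e ∈ normals, form e.1 p.1 < 0
  exists_facet : ∀ e ∈ normals, ∃ x : HypSpace n,
    form e.1 x.1 = 0 ∧ ∀ f ∈ normals, f ≠ e → form f.1 x.1 < 0

namespace ConvexPolyhedron

variable {n : ℕ} (Q : ConvexPolyhedron n)

/-- The underlying set of the polyhedron. -/
def carrier : Set (HypSpace n) := ⋂ e ∈ Q.normals, halfSpace e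

/-- The wall (codimension-one face) of `Q` with outward normal `e ∈ Q.normals`. -/
def wall (e : UnitNormal n) : Set (HypSpace n) := Q.carrier ∩ hyperplane e

/-- Two walls meet if they have a common point in `H^n`. -/
def Meet (e f : UnitNormal n) : Prop := (Q.wall e ∩ Q.wall f).Nonempty

/-- The group `W(Q)` generated by the reflections across the walls of `Q`. -/
def coxeterGroup : Subgroup (Equiv.Perm (HypSpace n)) :=
  Subgroup.closure (reflection '' Q.normals)

end ConvexPolyhedron

/-- The dihedral angle of the intersection of the half-spaces with outward unit normals `e` and
`f`, when their hyperplanes intersect: the angle between the normals is its supplement. -/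
noncomputable def dihedralAngle {n : ℕ} (e f : UnitNormal n) : ℝ :=
  Real.arccos (-form e.1 f.1)

namespace ConvexPolyhedron

variable {n : ℕ} (Q : ConvexPolyhedron n)

/-- `Q` is a Coxeter polyhedron: all its dihedral angles are integral submultiples of `π`. -/
def IsCoxeter : Prop :=
  ∀ e ∈ Q.normals, ∀ f ∈ Q.normals, e ≠ f → Q.Meet e f →
    ∃ m : ℕ, 1 ≤ m ∧ dihedralAngle e f = Real.pi / m

/-- The wall of `Q` with normal `e` is a doubling wall: the angles that it makes with the other
walls it meets are all even submultiples of `π`. -/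
def IsDoublingWall (e : UnitNormal n) : Prop :=
  e ∈ Q.normals ∧ ∀ f ∈ Q.normals, f ≠ e → Q.Meet e f →
    ∃ k : ℕ, 1 ≤ k ∧ dihedralAngle e f = Real.pi / (2 * k : ℕ)

/-- `Q` is redoublable: a Coxeter polyhedron with two doubling walls that do not meet in `H^n`. -/
def IsRedoublable : Prop :=
  Q.IsCoxeter ∧ ∃ e f : UnitNormal n,
    Q.IsDoublingWall e ∧ Q.IsDoublingWall f ∧ e ≠ f ∧ ¬ Q.Meet e f

end ConvexPolyhedron

end HypCox

/-!
A doubling wall is a generator of `W(Q)` all of whose orders with the other generators are even or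
infinite.  If two such generators `e` and `f` have no relation with each other, then `W(Q)` acts on
a path with `I` vertices: `f` and `e` exchange the ends of alternate edges, and all other generators
act trivially.  The stabilizer of an end of the path has index `I`.  Its Schreier graph is a path
with loops, so Schreier's lemma yields one generator for each loop, and this is a conjugate of a
generator of `W(Q)`, that is, a reflection
(`CoxeterSystem.exists_index_eq_closure_conj`).

This requires the Coxeter presentation of `W(Q)`, with no relation between walls that do not meet.
It rests on two facts.

* Walls that do not meet have hyperplanes that do not cross
  (`ConvexPolyhedron.form_le_neg_one_of_not_meet`, a theorem of Andreev for acute-angled polyhedra):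
  their unit normals have product at most `-1`.  Indeed, if all angles along a wall are at most
  `π / 2`, then the orthogonal projection to its hyperplane maps `Q` into the wall, because a
  segment in the hyperplane that starts in the wall cannot leave it.  So the normals of *all* pairs
  of walls have nonpositive product.  If two hyperplanes cross, then the orthogonal projection to
  their intersection adds nonnegative multiples of the two normals, so it maps `Q` into `Q`, and the
  walls meet.
* Tits' criterion (`CoxeterSystem.injective_of_halfSpaces`): an action of a Coxeter group with
  half-spaces for the generators is faithful if the half-spaces behave well under each dihedral
  subgroup generated by two of the generators.  For `W(Q)`, the dihedral subgroups are controlled by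
  Chebyshev polynomials of the second kind, evaluated at `cos (π / m)` or at a number `≥ 1`
  (`form_altProd_reflection`).
-/

namespace HypCox

/-! ### Timelike vectors and the geometry of the hyperboloid -/

variable {n : ℕ}

theorem form_add_right (x y z : Fin (n + 1) → ℝ) : form x (y + z) = form x y + form x z := by
  simp only [form, Pi.add_apply, mul_add, Finset.sum_add_distrib]
  ring

theorem form_smul_right (a : ℝ) (x y : Fin (n + 1) → ℝ) : form x (a • y) = a * form x y := by
  simp only [form, Pi.smul_apply, smul_eq_mul, mul_add, Finset.mul_sum]
  congr 1
  · ring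
  · exact Finset.sum_congr rfl fun i _ => by ring

theorem form_add_left (x y z : Fin (n + 1) → ℝ) : form (y + z) x = form y x + form z x := by
  rw [form_comm, form_add_right, form_comm x y, form_comm x z]

theorem form_smul_left (a : ℝ) (x y : Fin (n + 1) → ℝ) : form (a • y) x = a * form y x := by
  rw [form_comm, form_smul_right, form_comm x y]

theorem form_sub_right (x y z : Fin (n + 1) → ℝ) : form x (y - z) = form x y - form x z := by
  simpa using form_sub_smul_right x y z 1

theorem continuous_form_self : Continuous fun x : Fin (n + 1) → ℝ => form x x := by
  unfold form
  fun_prop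

theorem continuous_form_right (x : Fin (n + 1) → ℝ) : Continuous fun y => form x y := by
  unfold form
  fun_prop

/-- Any two points of the hyperboloid sheet have negative product. -/
theorem form_neg_of_mem (x y : HypSpace n) : form x.1 y.1 < 0 := by
  obtain ⟨x, hx, hx0⟩ := x
  obtain ⟨y, hy, hy0⟩ := y
  have hcs := Finset.sum_mul_sq_le_sq_mul_sq Finset.univ
    (fun i : Fin n => x i.succ) (fun i : Fin n => y i.succ)
  simp only [form, ← pow_two] at hx hy ⊢
  have h0 : 0 < x 0 * y 0 := mul_pos hx0 hy0
  have hX : ∑ i : Fin n, x i.succ ^ 2 = x 0 ^ 2 - 1 := by linarith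
  have hY : ∑ i : Fin n, y i.succ ^ 2 = y 0 ^ 2 - 1 := by linarith
  have hX0 : 0 ≤ ∑ i : Fin n, x i.succ ^ 2 := Finset.sum_nonneg fun i _ => sq_nonneg _
  have hY0 : 0 ≤ ∑ i : Fin n, y i.succ ^ 2 := Finset.sum_nonneg fun i _ => sq_nonneg _
  rw [hX] at hcs hX0
  rw [hY] at hcs hY0
  have h2 : (∑ i : Fin n, x i.succ * y i.succ) ^ 2 < (x 0 * y 0) ^ 2 := by nlinarith
  linarith [lt_of_pow_lt_pow_left₀ 2 h0.le h2]

/-- The orthogonal complement of a timelike vector is positive definite. -/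
theorem form_self_pos_of_orthogonal {z : HypSpace n} {v : Fin (n + 1) → ℝ}
    (h : form z.1 v = 0) (hv : v ≠ 0) : 0 < form v v := by
  obtain ⟨z, hz, hz0⟩ := z
  have hcs := Finset.sum_mul_sq_le_sq_mul_sq Finset.univ
    (fun i : Fin n => z i.succ) (fun i : Fin n => v i.succ)
  simp only [form, ← pow_two] at hz h ⊢
  have hS : ∑ i : Fin n, z i.succ * v i.succ = z 0 * v 0 := by linarith
  have hZ : ∑ i : Fin n, z i.succ ^ 2 = z 0 ^ 2 - 1 := by linarith
  have hV0 : 0 ≤ ∑ i : Fin n, v i.succ ^ 2 := Finset.sum_nonneg fun i _ => sq_nonneg _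
  rw [hS, hZ] at hcs
  rcases hV0.eq_or_lt with hV | hV
  · exfalso
    apply hv
    have hs : ∀ i : Fin n, v i.succ = 0 := fun i => by
      have := (Finset.sum_eq_zero_iff_of_nonneg fun i _ => sq_nonneg (v (Fin.succ i))).1 hV.symm i
        (Finset.mem_univ i)
      simpa using this
    have h0 : z 0 * v 0 = 0 := by simpa [hs] using hS.symm
    funext i
    refine Fin.cases ?_ hs i
    simpa [hz0.ne'] using h0
  · have : z 0 ^ 2 * v 0 ^ 2 < z 0 ^ 2 * ∑ i : Fin n, v i.succ ^ 2 := by nlinarith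
    linarith [lt_of_mul_lt_mul_left this (sq_nonneg (z 0))]

theorem form_normalize {v : Fin (n + 1) → ℝ} (hv : form v v < 0) :
    form ((√(-form v v))⁻¹ • v) ((√(-form v v))⁻¹ • v) = -1 := by
  have hs : √(-form v v) * √(-form v v) = -form v v := Real.mul_self_sqrt (by linarith)
  rw [form_smul_left, form_smul_right, ← mul_assoc, ← mul_inv, hs, inv_neg, neg_mul,
    inv_mul_cancel₀ hv.ne]

/-- The central projection of the open future cone onto the hyperboloid sheet. -/
noncomputable def centralProj (v : Fin (n + 1) → ℝ) (hv : form v v < 0) (h0 : 0 < v 0) :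
    HypSpace n :=
  ⟨(√(-form v v))⁻¹ • v, form_normalize hv,
    mul_pos (inv_pos.2 (Real.sqrt_pos.2 (neg_pos.2 hv))) h0⟩

/-- A timelike vector having negative product with a point of `H^n` is, up to a positive factor,
a point of `H^n`. -/
theorem exists_pos_smul_eq (x : HypSpace n) {v : Fin (n + 1) → ℝ} (hv : form v v < 0)
    (hxv : form x.1 v < 0) : ∃ y : HypSpace n, ∃ c : ℝ, 0 < c ∧ y.1 = c • v := by
  have h : 0 < (√(-form v v))⁻¹ := inv_pos.2 (Real.sqrt_pos.2 (neg_pos.2 hv))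
  refine ⟨⟨_, form_normalize hv, pos_of_form_neg x.2.1 x.2.2 (form_normalize hv) ?_⟩, _, h, rfl⟩
  rw [form_smul_right]
  exact mul_neg_of_pos_of_neg h hxv

namespace ConvexPolyhedron

/-! ### Non-adjacent walls of an acute-angled polyhedron -/

variable (Q : ConvexPolyhedron n)

theorem mem_carrier {x : HypSpace n} : x ∈ Q.carrier ↔ ∀ f ∈ Q.normals, form f.1 x.1 ≤ 0 := by
  simp [carrier, halfSpace]

/-- If the angles along the wall with normal `e` are at most `π / 2`, then a point `p` of the
hyperplane `e^⊥` lies in `Q` as soon as no half-space that is active at some point of the wall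
excludes it: the ray from a point of the wall towards `p` never leaves the wall. -/
theorem form_nonpos_of_forall_active {e : UnitNormal n} (he : e ∈ Q.normals) {p : HypSpace n}
    (hep : form e.1 p.1 = 0)
    (hp : ∀ g ∈ Q.normals, g ≠ e → Q.Meet e g → form g.1 p.1 ≤ 0)
    {g : UnitNormal n} (hg : g ∈ Q.normals) : form g.1 p.1 ≤ 0 := by
  obtain ⟨y, hey, hy⟩ := Q.exists_facet e he
  have hyQ : ∀ f ∈ Q.normals, form f.1 y.1 ≤ 0 := fun f hf => by
    by_cases h : f = e
    · rw [h, hey]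
    · exact (hy f hf h).le
  have hyp := form_neg_of_mem y p
  -- The ray from `y` towards `p`, with `|t|` in place of `t` to have it defined on all of `ℝ`.
  have hray : ∀ t : ℝ, form (y.1 + |t| • p.1) (y.1 + |t| • p.1) < 0 := fun t => by
    rw [form_add_left, form_add_right, form_add_right, form_smul_left, form_smul_left,
      form_smul_right, form_smul_right, y.2.1, p.2.1, form_comm p.1 y.1]
    nlinarith [abs_nonneg t, mul_nonneg (abs_nonneg t) (abs_nonneg t)]
  have hray0 : ∀ t : ℝ, 0 < (y.1 + |t| • p.1) 0 := fun t => by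
    have := mul_nonneg (abs_nonneg t) p.2.2.le
    simpa using add_pos_of_pos_of_nonneg y.2.2 this
  let γ : ℝ → HypSpace n := fun t => centralProj _ (hray t) (hray0 t)
  have hγc : Continuous γ := by
    have hc : Continuous fun t : ℝ => y.1 + |t| • p.1 := by fun_prop
    have hn : Continuous fun t : ℝ => √(-form (y.1 + |t| • p.1) (y.1 + |t| • p.1)) :=
      (continuous_form_self.comp hc).neg.sqrt
    exact ((hn.inv₀ fun t => (Real.sqrt_pos.2 (neg_pos.2 (hray t))).ne').smul hc).subtype_mk _
  have hγ : ∀ (f : UnitNormal n) (t : ℝ), ∃ c : ℝ, 0 < c ∧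
      form f.1 (γ t).1 = c * (form f.1 y.1 + |t| * form f.1 p.1) := fun f t =>
    ⟨_, inv_pos.2 (Real.sqrt_pos.2 (neg_pos.2 (hray t))), by
      rw [← form_smul_right |t|, ← form_add_right, ← form_smul_right]; rfl⟩
  let s : Set ℝ := {t | ∀ f ∈ Q.normals, form f.1 y.1 + t * form f.1 p.1 ≤ 0}
  have hs : IsClosed s := by
    have : s = ⋂ f ∈ Q.normals, {t : ℝ | form f.1 y.1 + t * form f.1 p.1 ≤ 0} := by
      ext; simp [s]
    rw [this]
    exact isClosed_biInter fun f _ => isClosed_le (by fun_prop) (by fun_prop)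
  have key : ∀ b : ℝ, Set.Icc 0 b ⊆ s := fun b => by
    refine (hs.inter isClosed_Icc).Icc_subset_of_forall_exists_gt (fun f hf => ?_) ?_
    · simpa using hyQ f hf
    rintro t ⟨hts, ht0, -⟩ u (hu : t < u)
    let N : Set Q.normals := {f | form f.1.1 (γ t).1 < 0}
    have hZ : IsClosed (⋃ f : N, hyperplane f.1.1) := by
      refine LocallyFinite.isClosed_iUnion
        (Q.locallyFinite.comp_injective Subtype.val_injective) fun f => ?_
      exact isClosed_eq ((continuous_form_right _).comp continuous_subtype_val) continuous_const
    have hU : γ ⁻¹' (⋃ f : N, hyperplane f.1.1)ᶜ ∈ nhds t := by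
      refine (hZ.isOpen_compl.preimage hγc).mem_nhds ?_
      simp only [Set.mem_preimage, Set.mem_compl_iff, Set.mem_iUnion, not_exists]
      intro f hf
      exact absurd hf f.2.ne
    obtain ⟨ε, hε, hball⟩ := Metric.mem_nhds_iff.1 hU
    let v := min u (t + ε / 2)
    have htv : t < v := lt_min hu (by linarith)
    have hvε : v ≤ t + ε / 2 := min_le_right _ _
    refine ⟨v, fun f hf => ?_, htv, min_le_left _ _⟩
    obtain ⟨c, hc, hct⟩ := hγ f t
    rw [abs_of_nonneg ht0] at hct
    rcases (hts f hf).eq_or_lt with h0 | hneg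
    · have hfp : form f.1 p.1 ≤ 0 := by
        by_cases hfe : f = e
        · rw [hfe, hep]
        · refine hp f hf hfe ⟨γ t, ?_, ?_⟩ <;> refine ⟨Q.mem_carrier.2 fun f' hf' => ?_, ?_⟩
          · obtain ⟨c', hc', h'⟩ := hγ f' t
            rw [h', abs_of_nonneg ht0]
            exact mul_nonpos_of_nonneg_of_nonpos hc'.le (hts f' hf')
          · obtain ⟨c', hc', h'⟩ := hγ e t
            change form e.1 (γ t).1 = 0
            rw [h', hey, hep]; ring
          · obtain ⟨c', hc', h'⟩ := hγ f' t
            rw [h', abs_of_nonneg ht0]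
            exact mul_nonpos_of_nonneg_of_nonpos hc'.le (hts f' hf')
          · change form f.1 (γ t).1 = 0
            rw [hct, h0, mul_zero]
      nlinarith
    · by_contra! hpos
      obtain ⟨w, hw, hw0⟩ := intermediate_value_Icc htv.le
        (f := fun t => form f.1 y.1 + t * form f.1 p.1) (by fun_prop) ⟨hneg.le, hpos.le⟩
      have hwb : w ∈ Metric.ball t ε := by
        rw [Metric.mem_ball, Real.dist_eq, abs_of_nonneg (by linarith [hw.1])]
        linarith [hw.2]
      have hmem := hball hwb
      simp only [Set.mem_preimage, Set.mem_compl_iff, Set.mem_iUnion, not_exists] at hmem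
      refine hmem ⟨⟨f, hf⟩, ?_⟩ ?_
      · change form f.1 (γ t).1 < 0
        rw [hct]
        exact mul_neg_of_pos_of_neg hc hneg
      · obtain ⟨c', hc', h'⟩ := hγ f w
        change form f.1 (γ w).1 = 0
        rw [h', abs_of_nonneg (ht0.trans hw.1)]
        exact mul_eq_zero_of_right _ hw0
  by_contra! hpos
  -- For large `t` the ray would be on the wrong side of `g`.
  have hT : 0 ≤ (1 - form g.1 y.1) / form g.1 p.1 :=
    div_nonneg (by linarith [hyQ g hg]) hpos.le
  have := key _ ⟨hT, le_rfl⟩ g hg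
  rw [div_mul_cancel₀ _ hpos.ne'] at this
  linarith

/-- In a polyhedron whose dihedral angles along the wall with normal `e` are at most `π / 2`,
the normal `e` makes a nonpositive product with *all* other normals: the orthogonal projection to
`e^⊥` maps `Q` into its wall, so it maps an interior point of the facet of `g` into `Q`. -/
theorem form_nonpos_of_acute {e : UnitNormal n} (he : e ∈ Q.normals)
    (hacute : ∀ g ∈ Q.normals, g ≠ e → Q.Meet e g → form e.1 g.1 ≤ 0)
    {g : UnitNormal n} (hg : g ∈ Q.normals) (hge : g ≠ e) : form e.1 g.1 ≤ 0 := by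
  obtain ⟨x, hgx, hx⟩ := Q.exists_facet g hg
  have hex : form e.1 x.1 < 0 := hx e he hge.symm
  have hxQ : ∀ f ∈ Q.normals, form f.1 x.1 ≤ 0 := fun f hf => by
    by_cases h : f = g
    · rw [h, hgx]
    · exact (hx f hf h).le
  have hxe : form x.1 e.1 = form e.1 x.1 := form_comm _ _
  obtain ⟨p, c, hc, hp⟩ := exists_pos_smul_eq x (v := x.1 - form e.1 x.1 • e.1)
    (by
      simp only [form_sub_smul_left, form_sub_smul_right, x.2.1, e.2, hxe]
      nlinarith)
    (by
      simp only [form_sub_smul_right, x.2.1, hxe]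
      nlinarith)
  have hfp : ∀ f : UnitNormal n,
      form f.1 p.1 = c * (form f.1 x.1 - form e.1 x.1 * form e.1 f.1) := fun f => by
    rw [hp, form_smul_right, form_sub_smul_right, form_comm f.1 e.1]
  have hgp : form g.1 p.1 ≤ 0 := by
    refine Q.form_nonpos_of_forall_active he ?_ (fun f hf hfe hm => ?_) hg
    · rw [hfp, e.2]; ring
    · rw [hfp]
      refine mul_nonpos_of_nonneg_of_nonpos hc.le ?_
      nlinarith [hacute f hf hfe hm, hxQ f hf]
  rw [hfp, hgx] at hgp
  by_contra! hpos
  nlinarith [mul_pos hc (mul_pos (neg_pos.2 hex) hpos)]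

/-- If all dihedral angles of `Q` are at most `π / 2`, then the hyperplanes of two walls that do
not meet do not cross either: otherwise the orthogonal projection of a point of `Q` to the
intersection of the two hyperplanes is a common point of the walls. -/
theorem form_le_neg_one_of_not_meet
    (hacute : ∀ e ∈ Q.normals, ∀ g ∈ Q.normals, g ≠ e → Q.Meet e g → form e.1 g.1 ≤ 0)
    {e f : UnitNormal n} (he : e ∈ Q.normals) (hf : f ∈ Q.normals) (hne : f ≠ e)
    (hm : ¬ Q.Meet e f) : form e.1 f.1 ≤ -1 := by
  have hall : ∀ a ∈ Q.normals, ∀ b ∈ Q.normals, b ≠ a → form a.1 b.1 ≤ 0 :=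
    fun a ha b hb hba => Q.form_nonpos_of_acute ha (hacute a ha) hb hba
  by_contra! hlt
  apply hm
  obtain ⟨x, hx⟩ := Q.exists_interior
  have hk0 := hall e he f hf hne
  set k := form e.1 f.1 with hk
  have hex := hx e he
  have hfx := hx f hf
  set α := form e.1 x.1 with hα
  set β := form f.1 x.1 with hβ
  have hfe : form f.1 e.1 = k := form_comm _ _
  have hxe : form x.1 e.1 = α := form_comm _ _
  have hxf : form x.1 f.1 = β := form_comm _ _
  have hD : 0 < 1 - k ^ 2 := by nlinarith
  -- The coefficients that make `x + a e + b f` orthogonal to `e` and `f`.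
  obtain ⟨a, ha⟩ : ∃ a, a = (β * k - α) / (1 - k ^ 2) := ⟨_, rfl⟩
  obtain ⟨b, hb⟩ : ∃ b, b = (α * k - β) / (1 - k ^ 2) := ⟨_, rfl⟩
  have ha0 : 0 ≤ a := by rw [ha]; exact div_nonneg (by nlinarith) hD.le
  have hb0 : 0 ≤ b := by rw [hb]; exact div_nonneg (by nlinarith) hD.le
  have h1 : α + a + b * k = 0 := by rw [ha, hb]; field_simp; ring
  have h2 : β + a * k + b = 0 := by rw [ha, hb]; field_simp; ring
  have hg : ∀ g : Fin (n + 1) → ℝ,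
      form g (x.1 + a • e.1 + b • f.1) = form g x.1 + a * form g e.1 + b * form g f.1 := fun g => by
    rw [form_add_right, form_add_right, form_smul_right, form_smul_right]
  have hev : form e.1 (x.1 + a • e.1 + b • f.1) = 0 := by rw [hg, e.2, ← hk, ← hα]; linarith
  have hfv : form f.1 (x.1 + a • e.1 + b • f.1) = 0 := by rw [hg, f.2, hfe, ← hβ]; linarith
  have hxv : form x.1 (x.1 + a • e.1 + b • f.1) < 0 := by
    rw [hg, x.2.1, hxe, hxf]
    nlinarith
  obtain ⟨p, c, hc, hp⟩ := exists_pos_smul_eq x (v := x.1 + a • e.1 + b • f.1)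
    (by rw [form_add_left, form_add_left, form_smul_left, form_smul_left, hev, hfv]; linarith) hxv
  have hep : form e.1 p.1 = 0 := by rw [hp, form_smul_right, hev, mul_zero]
  have hfp : form f.1 p.1 = 0 := by rw [hp, form_smul_right, hfv, mul_zero]
  have hpQ : p ∈ Q.carrier := Q.mem_carrier.2 fun g hgQ => by
    by_cases hge : g = e
    · rw [hge, hep]
    by_cases hgf : g = f
    · rw [hgf, hfp]
    rw [hp, form_smul_right, hg]
    refine mul_nonpos_of_nonneg_of_nonpos hc.le ?_
    nlinarith [hx g hgQ, mul_nonneg ha0 (neg_nonneg.2 (hall g hgQ e he (Ne.symm hge))),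
      mul_nonneg hb0 (neg_nonneg.2 (hall g hgQ f hf (Ne.symm hgf)))]
  exact ⟨p, ⟨hpQ, hep⟩, hpQ, hfp⟩

/-- Two distinct walls that meet at a dihedral angle `π / m` have `m ≥ 2`, and the product of
their normals is `-cos (π / m)`. -/
theorem form_eq_neg_cos {e f : UnitNormal n} (hne : e ≠ f) (hmeet : Q.Meet e f) {m : ℕ}
    (hm : 1 ≤ m) (h : dihedralAngle e f = Real.pi / m) :
    2 ≤ m ∧ form e.1 f.1 = -Real.cos (Real.pi / m) := by
  obtain ⟨z, ⟨-, hez⟩, -, hfz⟩ := hmeet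
  replace hez : form e.1 z.1 = 0 := hez
  replace hfz : form f.1 z.1 = 0 := hfz
  have hv := form_self_pos_of_orthogonal (z := z) (v := e.1 - f.1)
    (by rw [form_comm] at hez hfz; rw [form_sub_right, hez, hfz, sub_zero])
    (fun h => hne (Subtype.ext (sub_eq_zero.1 h)))
  have hlt : form e.1 f.1 < 1 := by
    rw [form_sub_right, form_comm _ e.1, form_comm _ f.1, form_sub_right, form_sub_right, e.2, f.2,
      form_comm f.1 e.1] at hv
    linarith
  have hm0 : (0 : ℝ) < m := by exact_mod_cast hm
  have hpos : 0 < dihedralAngle e f := by rw [h]; positivity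
  have h1 : -form e.1 f.1 < 1 := Real.arccos_pos.1 hpos
  have hcos : Real.cos (Real.pi / m) = -form e.1 f.1 := by
    rw [← h, dihedralAngle, Real.cos_arccos (by linarith) h1.le]
  refine ⟨?_, by linarith⟩
  by_contra! hm2
  obtain rfl : m = 1 := by omega
  rw [Nat.cast_one, div_one, Real.cos_pi] at hcos
  linarith

end ConvexPolyhedron

end HypCox

/-! ### Alternating products and Tits' criterion for faithfulness -/

/-- The alternating product `a * b * a * ⋯` with `k` factors, the first of which is `a`. -/
def altProd {G : Type*} [Monoid G] (a b : G) : ℕ → G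
  | 0 => 1
  | k + 1 => a * altProd b a k

theorem map_altProd {G H : Type*} [Monoid G] [Monoid H] (φ : G →* H) (a b : G) (k : ℕ) :
    φ (altProd a b k) = altProd (φ a) (φ b) k := by
  induction k generalizing a b with
  | zero => exact map_one φ
  | succ k ih => rw [altProd, altProd, map_mul, ih]

theorem altProd_add {G : Type*} [Monoid G] (a b : G) (i j : ℕ) :
    altProd a b (i + j) =
      altProd a b i * (if Even i then altProd a b j else altProd b a j) := by
  induction i generalizing a b with
  | zero => simp [altProd]
  | succ i ih =>
    rw [Nat.add_right_comm, altProd, altProd, ih, mul_assoc]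
    by_cases h : Even i <;> simp [h, Nat.even_add_one]

theorem altProd_two_mul {G : Type*} [Monoid G] (a b : G) (k : ℕ) :
    altProd a b (2 * k) = (a * b) ^ k := by
  induction k with
  | zero => simp [altProd]
  | succ k ih => rw [mul_add, mul_one, altProd, altProd, ih, pow_succ', mul_assoc]

/-- In a dihedral group of order `2 * m`, the two alternating products with a total number of
`2 * m` factors agree. -/
theorem altProd_comm_of_pow_eq_one {G : Type*} [Group G] {a b : G} (ha : a * a = 1)
    (hb : b * b = 1) {m : ℕ} (hab : (a * b) ^ m = 1) (hba : (b * a) ^ m = 1) {i j : ℕ}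
    (hij : i + j = 2 * m) : altProd b a i = altProd a b j := by
  induction i generalizing a b j with
  | zero => rw [show j = 2 * m by omega, altProd_two_mul, hab]; rfl
  | succ i ih =>
    rw [altProd, ih hb ha hba hab (show i + (j + 1) = 2 * m by omega), altProd, ← mul_assoc, hb,
      one_mul]

namespace CoxeterSystem

variable {B W : Type*} [Group W] {M : CoxeterMatrix B} (cs : CoxeterSystem M W)

theorem length_altProd_le (s t : B) (k : ℕ) :
    cs.length (altProd (cs.simple s) (cs.simple t) k) ≤ k := by
  induction k generalizing s t with
  | zero => simp [altProd]
  | succ k ih =>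
    have := cs.length_mul_le (cs.simple s) (altProd (cs.simple t) (cs.simple s) k)
    have := ih t s
    have := cs.length_simple s
    rw [altProd]
    omega

/-- If `s` is not a left descent of `w` but `t` is, then `w` factors as an alternating product
`t s t ⋯` with fewer than `M s t` factors, followed by a shorter element that has neither `s` nor
`t` as a left descent. -/
theorem exists_altProd_mul {w : W} {s t : B} (hs : ¬ cs.IsLeftDescent w s)
    (ht : cs.IsLeftDescent w t) : ∃ (k : ℕ) (v : W),
      w = altProd (cs.simple t) (cs.simple s) k * v ∧ cs.length v < cs.length w ∧
        ¬ cs.IsLeftDescent v s ∧ ¬ cs.IsLeftDescent v t ∧ (M s t ≠ 0 → k < M s t) := by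
  classical
  let P : ℕ → Prop := fun k => ∃ v : W,
    w = altProd (cs.simple t) (cs.simple s) k * v ∧ k + cs.length v = cs.length w
  have hP1 : P 1 := by
    refine ⟨cs.simple t * w, by simp [altProd], ?_⟩
    have := cs.length_simple_mul w t
    unfold IsLeftDescent at ht
    omega
  have hle : 1 ≤ cs.length w := by
    unfold IsLeftDescent at ht
    omega
  let k := Nat.findGreatest P (cs.length w)
  obtain ⟨v, hwv, hlen⟩ : P k := Nat.findGreatest_spec hle hP1
  have hk1 : 1 ≤ k := Nat.le_findGreatest hle hP1
  have hmax : ∀ j, P j → j ≤ k := fun j hj =>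
    Nat.le_findGreatest (by obtain ⟨v', -, h'⟩ := hj; omega) hj
  -- No letter that extends the alternating product is a descent of `v`, by maximality.
  have hnext : ∀ (r : B), altProd (cs.simple t) (cs.simple s) (k + 1) =
      altProd (cs.simple t) (cs.simple s) k * cs.simple r → ¬ cs.IsLeftDescent v r := by
    intro r hr hd
    have := hmax (k + 1) ⟨cs.simple r * v, by
        rw [hr, mul_assoc, cs.simple_mul_simple_cancel_left, hwv], by
        have := cs.length_simple_mul v r
        unfold IsLeftDescent at hd
        omega⟩
    omega
  -- The last letter of the alternating product is no descent of `v`, by length.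
  have hlast : ∀ (r : B), altProd (cs.simple t) (cs.simple s) k =
      altProd (cs.simple t) (cs.simple s) (k - 1) * cs.simple r → ¬ cs.IsLeftDescent v r := by
    intro r hr hd
    have h1 := cs.length_mul_le (altProd (cs.simple t) (cs.simple s) (k - 1)) (cs.simple r * v)
    rw [← mul_assoc, ← hr, ← hwv] at h1
    have h2 := cs.length_altProd_le t s (k - 1)
    unfold IsLeftDescent at hd
    omega
  have hstep : ∀ j, altProd (cs.simple t) (cs.simple s) (j + 1) =
      altProd (cs.simple t) (cs.simple s) j * cs.simple (if Even j then t else s) := fun j => by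
    rw [altProd_add]
    by_cases h : Even j <;> simp [h, altProd]
  have hn := hnext _ (hstep k)
  have hl := hlast (if Even (k - 1) then t else s) (by
    have := hstep (k - 1)
    rwa [Nat.sub_add_cancel hk1] at this)
  refine ⟨k, v, hwv, by omega, ?_, ?_, ?_⟩
  · by_cases h : Even k
    · rwa [if_neg (by rw [Nat.even_sub hk1]; simp [h])] at hl
    · rwa [if_neg h] at hn
  · by_cases h : Even k
    · rwa [if_pos h] at hn
    · rwa [if_pos (by rw [Nat.even_sub hk1]; simp [h])] at hl
  · intro hM
    by_contra! hk
    -- Otherwise the braid relation lets `w` start with `s` in a reduced word.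
    apply hs
    obtain ⟨j, hj⟩ := Nat.exists_eq_add_of_le hk
    obtain ⟨i, hi⟩ := Nat.exists_eq_succ_of_ne_zero hM
    have hbraid : altProd (cs.simple t) (cs.simple s) (M s t) =
        altProd (cs.simple s) (cs.simple t) (M s t) :=
      altProd_comm_of_pow_eq_one (cs.simple_mul_simple_self s) (cs.simple_mul_simple_self t)
        (cs.simple_mul_simple_pow s t) (cs.simple_mul_simple_pow' s t) (two_mul _).symm
    rw [hj, altProd_add, hbraid, hi, altProd, mul_assoc, mul_assoc] at hwv
    have hsw := cs.simple_mul_simple_cancel_left (w := altProd (cs.simple t) (cs.simple s) i *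
      ((if Even i.succ then altProd (cs.simple t) (cs.simple s) j
        else altProd (cs.simple s) (cs.simple t) j) * v)) s
    rw [← hwv] at hsw
    have h1 := cs.length_altProd_le t s i
    have h2 : cs.length (if Even i.succ then altProd (cs.simple t) (cs.simple s) j
        else altProd (cs.simple s) (cs.simple t) j) ≤ j := by
      split_ifs
      · exact cs.length_altProd_le t s j
      · exact cs.length_altProd_le s t j
    have h3 := cs.length_mul_le (altProd (cs.simple t) (cs.simple s) i)
      ((if Even i.succ then altProd (cs.simple t) (cs.simple s) j
        else altProd (cs.simple s) (cs.simple t) j) * v)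
    have h4 := cs.length_mul_le (if Even i.succ then altProd (cs.simple t) (cs.simple s) j
        else altProd (cs.simple s) (cs.simple t) j) v
    unfold IsLeftDescent
    rw [hsw]
    omega

/-- Tits' criterion.  Let a Coxeter group act on `X`, and let `p` be a point in the
intersection of "half-spaces" `A s` such that the generator `s` moves `A s` off itself, and that
alternating products `t s t ⋯` with fewer than `M s t` factors map `A s ∩ A t` into `A s`.  Then
the action is faithful. -/
theorem injective_of_halfSpaces {X : Type*} (F : W →* Equiv.Perm X) (A : B → Set X) {p : X}
    (hp : ∀ s, p ∈ A s) (hA : ∀ s, ∀ x ∈ A s, F (cs.simple s) x ∉ A s)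
    (hdih : ∀ s t, s ≠ t → ∀ k : ℕ, (M s t ≠ 0 → k < M s t) → ∀ x ∈ A s, x ∈ A t →
      F (altProd (cs.simple t) (cs.simple s) k) x ∈ A s) :
    Function.Injective F := by
  have key : ∀ (l : ℕ) (w : W), cs.length w = l → ∀ s, ¬ cs.IsLeftDescent w s → F w p ∈ A s := by
    intro l
    induction l using Nat.strong_induction_on with
    | _ l ih =>
      rintro w rfl s hs
      by_cases hw : w = 1
      · rw [hw, map_one]
        exact hp s
      obtain ⟨t, ht⟩ := cs.exists_leftDescent_of_ne_one hw
      obtain ⟨k, v, rfl, hv, hvs, hvt, hk⟩ := cs.exists_altProd_mul hs ht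
      rw [map_mul, Equiv.Perm.mul_apply]
      refine hdih s t (fun h => hs (h ▸ ht)) k hk _ ?_ ?_
      · exact ih _ hv v rfl s hvs
      · exact ih _ hv v rfl t hvt
  rw [injective_iff_map_eq_one]
  intro w hw
  by_contra hne
  obtain ⟨s, hs⟩ := cs.exists_leftDescent_of_ne_one hne
  have h1 := key _ (cs.simple s * w) rfl s (by
    unfold IsLeftDescent at hs ⊢
    rw [cs.simple_mul_simple_cancel_left]
    omega)
  rw [map_mul, hw, mul_one] at h1
  exact hA s p (hp s) h1

end CoxeterSystem

/-! ### A subgroup of given index generated by conjugates of the generators -/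

/-- The involution of the path `0, 1, …, m - 1` that exchanges the ends of each edge `{k, k + 1}`
for which `k + r` is even, and fixes the remaining vertices. -/
def pathInvolution (m r : ℕ) : Equiv.Perm (Fin m) :=
  Function.Involutive.toPerm
    (fun k => if h : Even (k.1 + r) ∧ k.1 + 1 < m then ⟨k.1 + 1, h.2⟩
      else if Even (k.1 + r) then k else ⟨k.1 - 1, by omega⟩)
    (by
      -- An odd sum `0 + r` is no exception: the truncated `0 - 1` is the fixed vertex `0`.
      rintro ⟨k, hk⟩
      apply Fin.ext
      rcases Nat.even_or_odd (k + r) with h | h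
      · by_cases h' : k + 1 < m
        · have : ¬ Even (k + 1 + r) := by rw [Nat.add_right_comm]; simpa [Nat.even_add_one] using h
          simp [h, h', this]
        · simp [h, h']
      · have h0 : ¬ Even (k + r) := Nat.not_even_iff_odd.2 h
        cases k with
        | zero =>
          rw [zero_add] at h0
          simp [h0]
        | succ k =>
          have : Even (k + r) := by
            rw [Nat.add_right_comm, Nat.even_add_one, not_not] at h0
            exact h0
          simp [h0, this, hk])

theorem pathInvolution_mul_self (m r : ℕ) : pathInvolution m r * pathInvolution m r = 1 :=
  Equiv.ext fun k => (pathInvolution m r).left_inv k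

theorem pathInvolution_of_even {m r : ℕ} {k : Fin m} (h : Even (k.1 + r)) (hk : k.1 + 1 < m) :
    pathInvolution m r k = ⟨k.1 + 1, hk⟩ := by
  simp [pathInvolution, Function.Involutive.toPerm, h, hk]

theorem pathInvolution_of_even_last {m r : ℕ} {k : Fin m} (h : Even (k.1 + r))
    (hk : ¬ k.1 + 1 < m) : pathInvolution m r k = k := by
  simp [pathInvolution, Function.Involutive.toPerm, h, hk]

theorem pathInvolution_of_odd_zero {m r : ℕ} {k : Fin m} (h : ¬ Even (k.1 + r))
    (hk : k.1 = 0) : pathInvolution m r k = k := by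
  apply Fin.ext
  simp only [pathInvolution, Function.Involutive.toPerm, Equiv.coe_fn_mk, h, false_and,
    dite_false, if_false]
  omega

namespace CoxeterSystem

variable {B W : Type*} [Group W] {M : CoxeterMatrix B} (cs : CoxeterSystem M W)

/-- Let `e` and `f` be generators of a Coxeter group without a relation between them, all of whose
orders with other generators are even or infinite.  Letting `e` and `f` act on a path with `m`
vertices by exchanging neighbours, and the other generators trivially, gives a transitive action;
its Schreier graph is a path with loops, so the stabilizer of a vertex, which has index `m`, is
generated by conjugates of the generators, one for each loop. -/
theorem exists_index_eq_closure_conj {e f : B} (hef : M e f = 0)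
    (he : ∀ i, i ≠ e → Even (M e i)) (hf : ∀ i, i ≠ f → Even (M f i)) {m : ℕ} (hm : 0 < m) :
    ∃ K : Subgroup W, K.index = m ∧ ∃ S : Set W,
      (∀ g ∈ S, ∃ (w : W) (i : B), g = w * cs.simple i * w⁻¹) ∧ K = Subgroup.closure S := by
  classical
  have hne : e ≠ f := by
    rintro rfl
    simp at hef
  let τ : B → Equiv.Perm (Fin m) := fun i =>
    if i = f then pathInvolution m 0 else if i = e then pathInvolution m 1 else 1
  have hττ : ∀ i, τ i * τ i = 1 := fun i => by
    dsimp only [τ]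
    split_ifs <;> simp [pathInvolution_mul_self]
  have hτ1 : ∀ i, i ≠ e → i ≠ f → τ i = 1 := fun i h1 h2 => by simp [τ, h1, h2]
  have hτpow : ∀ i k, Even k → τ i ^ k = 1 := by
    rintro i k ⟨j, rfl⟩
    rw [pow_add, ← (Commute.refl (τ i)).mul_pow, hττ, one_pow]
  have hlift : M.IsLiftable τ := by
    intro i j
    by_cases hij : i = j
    · rw [hij, hττ, one_pow]
    by_cases hi : i = e ∨ i = f
    · by_cases hj : j = e ∨ j = f
      · have : M i j = 0 := by
          rcases hi with rfl | rfl <;> rcases hj with rfl | rfl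
          · exact absurd rfl hij
          · exact hef
          · rw [M.symmetric, hef]
          · exact absurd rfl hij
        rw [this, pow_zero]
      · push Not at hj
        rw [hτ1 j hj.1 hj.2, mul_one]
        rcases hi with rfl | rfl
        · exact hτpow _ _ (he j hj.1)
        · exact hτpow _ _ (hf j hj.2)
    · push Not at hi
      rw [hτ1 i hi.1 hi.2, one_mul, M.symmetric]
      by_cases hje : j = e
      · exact hτpow _ _ (hje ▸ he i hi.1)
      by_cases hjf : j = f
      · exact hτpow _ _ (hjf ▸ hf i hi.2)
      rw [hτ1 j hje hjf, one_pow]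
  let ψ : W →* Equiv.Perm (Fin m) := cs.lift ⟨τ, hlift⟩
  have hψ : ∀ i, ψ (cs.simple i) = τ i := fun i => cs.lift_apply_simple hlift i
  -- The transversal: `c k` moves the vertex `0` to the vertex `k` along the path.
  let σ : ℕ → B := fun k => if Even k then f else e
  let c : ℕ → W := fun k => Nat.rec 1 (fun k g => cs.simple (σ k) * g) k
  have hc : ∀ k, c (k + 1) = cs.simple (σ k) * c k := fun k => rfl
  have hτσ : ∀ k (hk : k + 1 < m), τ (σ k) ⟨k, by omega⟩ = ⟨k + 1, hk⟩ := by
    intro k hk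
    by_cases h : Even k
    · have : τ (σ k) = pathInvolution m 0 := by simp [τ, σ, h]
      rw [this, pathInvolution_of_even (by simpa using h) hk]
    · have : τ (σ k) = pathInvolution m 1 := by simp [τ, σ, h, hne]
      rw [this, pathInvolution_of_even (by simpa [Nat.even_add_one] using h) hk]
  have hc0 : ∀ k (hk : k < m), ψ (c k) ⟨0, hm⟩ = ⟨k, hk⟩ := by
    intro k
    induction k with
    | zero => intro hk; simp [c]
    | succ k ih =>
      intro hk
      rw [hc, map_mul, Equiv.Perm.mul_apply, ih (by omega), hψ, hτσ k hk]
  -- Every edge of the Schreier graph is an edge of the path or a loop.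
  have hedge : ∀ (i : B) (k : Fin m), τ i k = k ∨ (i = σ k.1 ∧ k.1 + 1 < m) ∨
      ∃ j, k.1 = j + 1 ∧ i = σ j := by
    intro i k
    by_cases hif : i = f
    · have hτi : τ i = pathInvolution m 0 := by simp [τ, hif]
      by_cases h : Even k.1
      · by_cases hk : k.1 + 1 < m
        · exact Or.inr (Or.inl ⟨by simp [σ, h, hif], hk⟩)
        · rw [hτi]
          exact Or.inl (pathInvolution_of_even_last (by simpa using h) hk)
      · obtain ⟨j, hj⟩ := Nat.exists_eq_succ_of_ne_zero (n := k.1) fun h0 => h (by simp [h0])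
        refine Or.inr (Or.inr ⟨j, hj, ?_⟩)
        rw [hj, Nat.succ_eq_add_one, Nat.even_add_one, not_not] at h
        simp [σ, h, hif]
    by_cases hie : i = e
    · have hτi : τ i = pathInvolution m 1 := by simp [τ, hie, hne]
      by_cases h : Even k.1
      · rcases Nat.eq_zero_or_eq_succ_pred k.1 with h0 | hj
        · rw [hτi]
          exact Or.inl (pathInvolution_of_odd_zero (by simpa [Nat.even_add_one] using h) h0)
        · refine Or.inr (Or.inr ⟨_, hj, ?_⟩)
          rw [hj, Nat.succ_eq_add_one, Nat.even_add_one] at h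
          exact hie.trans (if_neg h).symm
      · by_cases hk : k.1 + 1 < m
        · exact Or.inr (Or.inl ⟨by simp [σ, h, hie], hk⟩)
        · rw [hτi]
          exact Or.inl (pathInvolution_of_even_last (by simpa [Nat.even_add_one] using h) hk)
    · rw [hτ1 i hie hif]
      exact Or.inl rfl
  let S : Set W := {g | (∃ (w : W) (i : B), g = w * cs.simple i * w⁻¹) ∧ ψ g ⟨0, hm⟩ = ⟨0, hm⟩}
  have hdecomp : ∀ g : W, ∃ k, k < m ∧ ∃ r ∈ Subgroup.closure S, g = c k * r := by
    intro g
    induction g using cs.simple_induction_left with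
    | one => exact ⟨0, hm, 1, one_mem _, by simp [c]⟩
    | mul_simple_left g i ih =>
      obtain ⟨k, hk, r, hr, rfl⟩ := ih
      rcases hedge i ⟨k, hk⟩ with h | ⟨h, hk1⟩ | ⟨j, hj, h⟩
      · refine ⟨k, hk, (c k)⁻¹ * cs.simple i * c k * r, mul_mem (Subgroup.subset_closure ?_) hr,
          by group⟩
        refine ⟨⟨(c k)⁻¹, i, by rw [inv_inv]⟩, ?_⟩
        rw [map_mul, map_mul, Equiv.Perm.mul_apply, Equiv.Perm.mul_apply, hc0 k hk, hψ, h, map_inv,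
          Equiv.Perm.inv_eq_iff_eq, hc0 k hk]
      · exact ⟨k + 1, hk1, r, hr, by rw [hc, h, mul_assoc]⟩
      · dsimp only at hj
        exact ⟨j, by omega, r, hr, by
          rw [hj, hc, h, mul_assoc, cs.simple_mul_simple_cancel_left]⟩
  let _ : MulAction W (Fin m) := MulAction.compHom (Fin m) ψ
  have hsmul : ∀ (g : W) (k : Fin m), g • k = ψ g k := fun _ _ => rfl
  have : MulAction.IsPretransitive W (Fin m) := by
    refine MulAction.isPretransitive_iff_base (G := W) (⟨0, hm⟩ : Fin m) |>.2 fun k => ?_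
    exact ⟨c k, hc0 k k.2⟩
  refine ⟨MulAction.stabilizer W (⟨0, hm⟩ : Fin m), ?_, S, fun g hg => hg.1, le_antisymm ?_ ?_⟩
  · rw [MulAction.index_stabilizer_of_transitive, Nat.card_eq_fintype_card, Fintype.card_fin]
  · intro g hg
    have hr0 : Subgroup.closure S ≤ MulAction.stabilizer W (⟨0, hm⟩ : Fin m) :=
      (Subgroup.closure_le _).2 fun g hg => MulAction.mem_stabilizer_iff.2 hg.2
    obtain ⟨k, hk, r, hr, rfl⟩ := hdecomp g
    have h1 := MulAction.mem_stabilizer_iff.1 hg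
    rw [mul_smul, MulAction.mem_stabilizer_iff.1 (hr0 hr), hsmul, hc0 k hk, Fin.mk.injEq] at h1
    rw [h1]
    simpa [c] using hr
  · exact (Subgroup.closure_le _).2 fun g hg => MulAction.mem_stabilizer_iff.2 hg.2

end CoxeterSystem

namespace HypCox

/-! ### Dihedral groups generated by two reflections -/

variable {n : ℕ}

theorem form_reflection (e f : UnitNormal n) (x : HypSpace n) :
    form f.1 (reflection e x).1 = form f.1 x.1 - 2 * form e.1 x.1 * form f.1 e.1 :=
  form_sub_smul_right _ _ _ _

theorem form_reflection_self (e : UnitNormal n) (x : HypSpace n) :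
    form e.1 (reflection e x).1 = -form e.1 x.1 := by
  rw [form_reflection, e.2]
  ring

theorem reflection_mul_self (e : UnitNormal n) : reflection e * reflection e = 1 :=
  Equiv.ext fun x => (reflection e).left_inv x

theorem reflection_inv (e : UnitNormal n) : (reflection e)⁻¹ = reflection e :=
  inv_eq_of_mul_eq_one_left (reflection_mul_self e)

/-- The values at `c` of the rescaled Chebyshev polynomials of the second kind, with the index
shifted by one, so that `chebCoeff (cos θ) k = sin (k θ) / sin θ`. -/
def chebCoeff (c : ℝ) : ℕ → ℝ
  | 0 => 0
  | 1 => 1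
  | k + 2 => 2 * c * chebCoeff c (k + 1) - chebCoeff c k

theorem chebCoeff_cos_mul_sin (θ : ℝ) (k : ℕ) :
    chebCoeff (Real.cos θ) k * Real.sin θ = Real.sin (k * θ) := by
  induction k using Nat.twoStepInduction with
  | zero => simp [chebCoeff]
  | one => simp [chebCoeff]
  | more k h0 h1 =>
    have e2 : ((k + 2 : ℕ) : ℝ) * θ = ((k + 1 : ℕ) : ℝ) * θ + θ := by push_cast; ring
    have e0 : (k : ℝ) * θ = ((k + 1 : ℕ) : ℝ) * θ - θ := by push_cast; ring
    rw [e0, Real.sin_sub] at h0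
    rw [chebCoeff, sub_mul, mul_assoc, h1, h0, e2, Real.sin_add]
    ring

theorem chebCoeff_succ_bounds {c : ℝ} (hc : 1 ≤ c) (k : ℕ) :
    0 ≤ chebCoeff c k ∧ chebCoeff c k ≤ chebCoeff c (k + 1) ∧ 1 ≤ chebCoeff c (k + 1) := by
  induction k with
  | zero => simp [chebCoeff]
  | succ k ih =>
    obtain ⟨h0, h1, h2⟩ := ih
    rw [chebCoeff]
    refine ⟨by linarith, ?_, ?_⟩ <;> nlinarith

/-- The product of a normal `e` with the image of `x` under an alternating product `f e f ⋯` of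
reflections. -/
theorem form_altProd_reflection (e f : UnitNormal n) (x : HypSpace n) (k : ℕ) :
    form e.1 (altProd (reflection f) (reflection e) k x).1 =
      if Even k then
        chebCoeff (-form e.1 f.1) (k + 1) * form e.1 x.1 +
          chebCoeff (-form e.1 f.1) k * form f.1 x.1
      else
        chebCoeff (-form e.1 f.1) k * form e.1 x.1 +
          chebCoeff (-form e.1 f.1) (k + 1) * form f.1 x.1 := by
  induction k using Nat.twoStepInduction generalizing e f with
  | zero => simp [altProd, chebCoeff]
  | one =>
    simp only [altProd, mul_one, form_reflection, Nat.not_even_one, if_false, chebCoeff]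
    ring
  | more k h0 h1 =>
    rw [altProd, Equiv.Perm.mul_apply, form_reflection, h1 f e, altProd, Equiv.Perm.mul_apply,
      form_reflection_self, h0 e f, form_comm f.1 e.1,
      show chebCoeff (-form e.1 f.1) (k + 2 + 1) =
        2 * -form e.1 f.1 * chebCoeff (-form e.1 f.1) (k + 1 + 1) -
          chebCoeff (-form e.1 f.1) (k + 1) from rfl,
      show chebCoeff (-form e.1 f.1) (k + 1 + 1) =
        2 * -form e.1 f.1 * chebCoeff (-form e.1 f.1) (k + 1) -
          chebCoeff (-form e.1 f.1) k from rfl]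
    by_cases h : Even k
    · have h2 : Even (k + 2) := by simpa [Nat.even_add] using h
      simp only [h, h2, Nat.even_add_one, not_true_eq_false, if_true, if_false]
      ring
    · have h2 : ¬ Even (k + 2) := by simpa [Nat.even_add] using h
      simp only [h, h2, Nat.even_add_one, not_false_eq_true, if_true, if_false]
      ring

theorem form_altProd_reflection_neg {e f : UnitNormal n} {x : HypSpace n} {k : ℕ}
    (h0 : 0 ≤ chebCoeff (-form e.1 f.1) k) (h1 : 0 ≤ chebCoeff (-form e.1 f.1) (k + 1))
    (hpos : 0 < chebCoeff (-form e.1 f.1) k ∨ 0 < chebCoeff (-form e.1 f.1) (k + 1))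
    (he : form e.1 x.1 < 0) (hf : form f.1 x.1 < 0) :
    form e.1 (altProd (reflection f) (reflection e) k x).1 < 0 := by
  rw [form_altProd_reflection]
  split_ifs <;> rcases hpos with h | h <;> nlinarith

theorem exists_altProd_reflection_eq_add (e f : UnitNormal n) (x : HypSpace n) (k : ℕ) :
    ∃ a b : ℝ,
      (altProd (reflection e) (reflection f) k x).1 = x.1 + a • e.1 + b • f.1 := by
  induction k generalizing e f with
  | zero => exact ⟨0, 0, by simp [altProd]⟩
  | succ k ih =>
    obtain ⟨a, b, h⟩ := ih f e
    refine ⟨b - 2 * form e.1 (altProd (reflection f) (reflection e) k x).1, a, ?_⟩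
    change (altProd (reflection f) (reflection e) k x).1 - (2 * form e.1 _) • e.1 = _
    rw [sub_smul, h]
    abel

theorem pi_div_mem_Ioo {m : ℕ} (hm : 2 ≤ m) : Real.pi / m ∈ Set.Ioo 0 Real.pi := by
  have h2 : (2 : ℝ) ≤ m := by exact_mod_cast hm
  exact ⟨by positivity, div_lt_self Real.pi_pos (by linarith)⟩

/-- The rotation `(r_e r_f)^m` fixes every `x`: it changes `x` by a vector of the plane spanned by
`e` and `f`, on which the form is nondegenerate, and it preserves the products of `x` with `e` and
`f` by the formula for alternating products. -/
theorem reflection_mul_reflection_pow {e f : UnitNormal n} {m : ℕ} (hm : 2 ≤ m)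
    (h : form e.1 f.1 = -Real.cos (Real.pi / m)) : (reflection e * reflection f) ^ m = 1 := by
  have hθ := pi_div_mem_Ioo hm
  have hsin := Real.sin_pos_of_mem_Ioo hθ
  have hm0 : (m : ℝ) ≠ 0 := by positivity
  have hc0 : chebCoeff (Real.cos (Real.pi / m)) (2 * m) = 0 := by
    have := chebCoeff_cos_mul_sin (Real.pi / m) (2 * m)
    rw [show ((2 * m : ℕ) : ℝ) * (Real.pi / m) = 2 * Real.pi by push_cast; field_simp,
      Real.sin_two_pi] at this
    exact (mul_eq_zero.1 this).resolve_right hsin.ne'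
  have hc1 : chebCoeff (Real.cos (Real.pi / m)) (2 * m + 1) = 1 := by
    have := chebCoeff_cos_mul_sin (Real.pi / m) (2 * m + 1)
    rw [show ((2 * m + 1 : ℕ) : ℝ) * (Real.pi / m) = Real.pi / m + 2 * Real.pi by
      push_cast; field_simp; ring, Real.sin_add_two_pi] at this
    exact mul_right_cancel₀ hsin.ne' (this.trans (one_mul _).symm)
  have hfix : ∀ e f : UnitNormal n, form e.1 f.1 = -Real.cos (Real.pi / m) → ∀ x : HypSpace n,
      form f.1 (((reflection e * reflection f) ^ m) x).1 = form f.1 x.1 := fun e f h x => by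
    rw [← altProd_two_mul, form_altProd_reflection, form_comm, h, neg_neg, hc0, hc1,
      if_pos (even_two_mul m)]
    ring
  have hfe : form f.1 e.1 = -Real.cos (Real.pi / m) := by rw [form_comm, h]
  ext1 x
  set z := ((reflection e * reflection f) ^ m) x with hz
  have hzf : form f.1 z.1 = form f.1 x.1 := hfix e f h x
  have hze : form e.1 z.1 = form e.1 x.1 := by
    -- `e` is handled by the inverse rotation, in which `e` and `f` are exchanged.
    have hinv : ((reflection f * reflection e) ^ m) z = x := by
      have : (reflection f * reflection e) = (reflection e * reflection f)⁻¹ := by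
        rw [mul_inv_rev, reflection_inv, reflection_inv]
      rw [hz, this, inv_pow]
      exact Equiv.symm_apply_apply _ x
    rw [← hfix f e hfe z, hinv]
  obtain ⟨a, b, hab⟩ := exists_altProd_reflection_eq_add e f x (2 * m)
  rw [altProd_two_mul, ← hz] at hab
  rw [hab, form_add_right, form_add_right, form_smul_right, form_smul_right, e.2, h] at hze
  rw [hab, form_add_right, form_add_right, form_smul_right, form_smul_right, f.2, hfe] at hzf
  have hsc := Real.sin_sq_add_cos_sq (Real.pi / m)
  set c := Real.cos (Real.pi / m)
  have hD : 0 < 1 - c ^ 2 := by nlinarith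
  have ha' : a = b * c := by linarith
  have hb' : b * (1 - c ^ 2) = 0 := by rw [ha'] at hzf; linarith
  have hb : b = 0 := (mul_eq_zero.1 hb').resolve_right hD.ne'
  apply Subtype.ext
  rw [hab, ha', hb]
  simp

/-! ### Conjugates of reflections -/

/-- The unit normal `f - 2⟨e, f⟩e`, the image of `f` under the reflection across `e^⊥`. -/
def UnitNormal.reflect (e f : UnitNormal n) : UnitNormal n :=
  ⟨f.1 - (2 * form e.1 f.1) • e.1, by
    rw [form_sub_smul_left, form_sub_smul_right, form_sub_smul_right, f.2, e.2,
      form_comm f.1 e.1]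
    ring⟩

theorem IsReflection.conj_reflection {g : Equiv.Perm (HypSpace n)} (hg : IsReflection g)
    (e : UnitNormal n) : IsReflection (reflection e * g * (reflection e)⁻¹) := by
  obtain ⟨f, rfl⟩ := hg
  refine ⟨e.reflect f, mul_inv_eq_of_eq_mul (Equiv.ext fun x => Subtype.ext ?_)⟩
  have hef : form f.1 e.1 = form e.1 f.1 := form_comm _ _
  change x.1 - (2 * form f.1 x.1) • f.1 - (2 * form e.1 (x.1 - (2 * form f.1 x.1) • f.1)) • e.1 =
    x.1 - (2 * form e.1 x.1) • e.1 - (2 * form (f.1 - (2 * form e.1 f.1) • e.1)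
      (x.1 - (2 * form e.1 x.1) • e.1)) • (f.1 - (2 * form e.1 f.1) • e.1)
  simp only [form_sub_smul_left, form_sub_smul_right, e.2, hef]
  funext i
  simp only [Pi.sub_apply, Pi.smul_apply, smul_eq_mul]
  ring

namespace ConvexPolyhedron

variable (Q : ConvexPolyhedron n)

theorem isReflection_conj {w g : Equiv.Perm (HypSpace n)} (hw : w ∈ Q.coxeterGroup)
    (hg : IsReflection g) : IsReflection (w * g * w⁻¹) := by
  induction hw using Subgroup.closure_induction'' generalizing g with
  | mem w hw =>
    obtain ⟨e, -, rfl⟩ := hw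
    exact hg.conj_reflection e
  | inv_mem w hw =>
    obtain ⟨e, -, rfl⟩ := hw
    rw [reflection_inv]
    exact hg.conj_reflection e
  | one => simpa using hg
  | mul a b _ _ ha hb =>
    have := ha (hb hg)
    rwa [show a * (b * g * b⁻¹) * a⁻¹ = a * b * g * (a * b)⁻¹ by group] at this

end ConvexPolyhedron

/-! ### The Coxeter presentation of `W(Q)` -/

open Classical in
/-- The integer `m ≥ 2` for which `c = -cos (π / m)`, and `0`, which stands for `∞`, if there is no
such integer. -/
noncomputable def angleOrder (c : ℝ) : ℕ :=
  if h : ∃ m : ℕ, 2 ≤ m ∧ c = -Real.cos (Real.pi / m) then h.choose else 0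

theorem angleOrder_spec {c : ℝ} (h : angleOrder c ≠ 0) :
    2 ≤ angleOrder c ∧ c = -Real.cos (Real.pi / angleOrder c) := by
  unfold angleOrder at h ⊢
  split_ifs at h ⊢ with h'
  · exact h'.choose_spec
  · exact absurd rfl h

theorem angleOrder_neg_cos {m : ℕ} (hm : 2 ≤ m) : angleOrder (-Real.cos (Real.pi / m)) = m := by
  have h : ∃ k : ℕ, 2 ≤ k ∧ -Real.cos (Real.pi / m) = -Real.cos (Real.pi / k) := ⟨m, hm, rfl⟩
  rw [angleOrder, dif_pos h]
  obtain ⟨hk, hc⟩ := h.choose_spec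
  generalize h.choose = k at hk hc ⊢
  have := Real.injOn_cos (Set.Ioo_subset_Icc_self (pi_div_mem_Ioo hm))
    (Set.Ioo_subset_Icc_self (pi_div_mem_Ioo hk)) (neg_inj.1 hc)
  have hm0 : (m : ℝ) ≠ 0 := by positivity
  have hk0 : (k : ℝ) ≠ 0 := by positivity
  rw [div_eq_div_iff hm0 hk0, mul_right_inj' Real.pi_ne_zero] at this
  exact_mod_cast this

theorem angleOrder_of_le_neg_one {c : ℝ} (hc : c ≤ -1) : angleOrder c = 0 := by
  by_contra h
  obtain ⟨h2, hc'⟩ := angleOrder_spec h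
  have hθ := pi_div_mem_Ioo h2
  have := Real.cos_lt_cos_of_nonneg_of_le_pi le_rfl hθ.2.le hθ.1
  rw [Real.cos_zero] at this
  linarith

namespace ConvexPolyhedron

variable (Q : ConvexPolyhedron n)

open Classical in
/-- The Coxeter matrix of a polyhedron: the entry at two distinct walls is `m` if the product of
their normals is `-cos (π / m)`, and `0` if there is no such `m`. -/
noncomputable def coxeterMatrix : CoxeterMatrix Q.normals where
  M := Matrix.of fun e f => if e = f then 1 else angleOrder (form e.1.1 f.1.1)
  isSymm := by
    ext e f
    simp only [Matrix.transpose_apply, Matrix.of_apply, form_comm f.1.1, eq_comm (a := f)]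
  diagonal e := by simp
  off_diagonal e f hef := by
    rw [Matrix.of_apply, if_neg hef]
    intro h
    have := (angleOrder_spec (c := form e.1.1 f.1.1) (by omega)).1
    omega

theorem coxeterMatrix_of_ne {e f : Q.normals} (h : e ≠ f) :
    Q.coxeterMatrix e f = angleOrder (form e.1.1 f.1.1) := if_neg h

theorem isLiftable_reflection :
    Q.coxeterMatrix.IsLiftable fun e : Q.normals => reflection e.1 := by
  intro e f
  by_cases hef : e = f
  · rw [hef, reflection_mul_self, one_pow]
  by_cases h0 : Q.coxeterMatrix e f = 0
  · rw [h0, pow_zero]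
  · rw [Q.coxeterMatrix_of_ne hef] at h0 ⊢
    obtain ⟨h2, hc⟩ := angleOrder_spec h0
    exact reflection_mul_reflection_pow h2 hc

variable {Q}

theorem IsCoxeter.acute (hQ : Q.IsCoxeter) {e f : UnitNormal n} (he : e ∈ Q.normals)
    (hf : f ∈ Q.normals) (hne : f ≠ e) (hmeet : Q.Meet e f) : form e.1 f.1 ≤ 0 := by
  obtain ⟨m, hm, h⟩ := hQ e he f hf hne.symm hmeet
  obtain ⟨h2, hc⟩ := Q.form_eq_neg_cos hne.symm hmeet hm h
  have h2' : (2 : ℝ) ≤ m := by exact_mod_cast h2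
  have := Real.cos_nonneg_of_mem_Icc (x := Real.pi / m)
    ⟨by linarith [(pi_div_mem_Ioo h2).1, Real.pi_pos],
      div_le_div_of_nonneg_left Real.pi_pos.le two_pos h2'⟩
  linarith

theorem IsCoxeter.form_le_neg_one (hQ : Q.IsCoxeter) {e f : UnitNormal n} (he : e ∈ Q.normals)
    (hf : f ∈ Q.normals) (hne : f ≠ e) (hmeet : ¬ Q.Meet e f) : form e.1 f.1 ≤ -1 :=
  Q.form_le_neg_one_of_not_meet (fun _ ha _ hb hab hm => hQ.acute ha hb hab hm) he hf hne hmeet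

/-- The abstract Coxeter group of a Coxeter polyhedron acts faithfully on `H^n`. -/
theorem IsCoxeter.injective_lift (hQ : Q.IsCoxeter) :
    Function.Injective
      (Q.coxeterMatrix.toCoxeterSystem.lift ⟨_, Q.isLiftable_reflection⟩) := by
  set cs := Q.coxeterMatrix.toCoxeterSystem
  have hF : ∀ e : Q.normals,
      cs.lift ⟨_, Q.isLiftable_reflection⟩ (cs.simple e) = reflection e.1 :=
    fun e => cs.lift_apply_simple Q.isLiftable_reflection e
  obtain ⟨p, hp⟩ := Q.exists_interior
  refine cs.injective_of_halfSpaces _ (fun e => {x | form e.1.1 x.1 < 0}) (p := p)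
    (fun e => hp e.1 e.2) (fun e x hx hx' => ?_) fun e f hef k hk x hxe hxf => ?_
  · rw [hF, Set.mem_ofPred_eq, form_reflection_self] at hx'
    rw [Set.mem_ofPred_eq] at hx
    linarith
  · rw [map_altProd, hF, hF]
    rw [Q.coxeterMatrix_of_ne hef] at hk
    have hne : f.1 ≠ e.1 := fun h => hef (Subtype.ext h.symm)
    by_cases hmeet : Q.Meet e.1 f.1
    · obtain ⟨m, hm, h⟩ := hQ e.1 e.2 f.1 f.2 hne.symm hmeet
      obtain ⟨h2, hc⟩ := Q.form_eq_neg_cos hne.symm hmeet hm h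
      rw [hc, angleOrder_neg_cos h2] at hk
      have hkm : k < m := hk (by omega)
      have hθ := pi_div_mem_Ioo h2
      have hsin := Real.sin_pos_of_mem_Ioo hθ
      have hm0 : (0 : ℝ) < m := by positivity
      have hmul : (m : ℝ) * (Real.pi / m) = Real.pi := by field_simp
      have hnn : ∀ j ≤ m, 0 ≤ chebCoeff (Real.cos (Real.pi / m)) j := fun j hj => by
        have hj' : (j : ℝ) ≤ m := by exact_mod_cast hj
        refine nonneg_of_mul_nonneg_left ?_ hsin
        rw [chebCoeff_cos_mul_sin]
        refine Real.sin_nonneg_of_nonneg_of_le_pi (mul_nonneg j.cast_nonneg hθ.1.le) ?_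
        conv_rhs => rw [← hmul]
        exact mul_le_mul_of_nonneg_right hj' hθ.1.le
      refine form_altProd_reflection_neg ?_ ?_ ?_ hxe hxf <;> rw [hc, neg_neg]
      · exact hnn k hkm.le
      · exact hnn (k + 1) hkm
      · rcases Nat.eq_zero_or_pos k with rfl | hk0
        · simp [chebCoeff]
        · left
          have hk' : (k : ℝ) < m := by exact_mod_cast hkm
          have hk0' : (0 : ℝ) < k := by exact_mod_cast hk0
          refine pos_of_mul_pos_left ?_ hsin.le
          rw [chebCoeff_cos_mul_sin]
          refine Real.sin_pos_of_pos_of_lt_pi (mul_pos hk0' hθ.1) ?_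
          conv_rhs => rw [← hmul]
          exact mul_lt_mul_of_pos_right hk' hθ.1
    · have hle := hQ.form_le_neg_one e.2 f.2 hne hmeet
      obtain ⟨h0, h1, h2⟩ := chebCoeff_succ_bounds (c := -form e.1.1 f.1.1) (by linarith) k
      exact form_altProd_reflection_neg h0 (by linarith) (Or.inr (by linarith)) hxe hxf

theorem range_lift_reflection :
    (Q.coxeterMatrix.toCoxeterSystem.lift ⟨_, Q.isLiftable_reflection⟩).range =
      Q.coxeterGroup := by
  set cs := Q.coxeterMatrix.toCoxeterSystem
  rw [MonoidHom.range_eq_map, ← cs.subgroup_closure_range_simple, MonoidHom.map_closure,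
    coxeterGroup, ← Set.range_comp, Set.image_eq_range]
  congr 2

theorem IsDoublingWall.even_coxeterMatrix (hQ : Q.IsCoxeter) {e : UnitNormal n}
    (he : Q.IsDoublingWall e) (f : Q.normals) (hne : f ≠ ⟨e, he.1⟩) :
    Even (Q.coxeterMatrix ⟨e, he.1⟩ f) := by
  have hfe : f.1 ≠ e := fun h => hne (Subtype.ext h)
  rw [Q.coxeterMatrix_of_ne hne.symm]
  by_cases hmeet : Q.Meet e f.1
  · obtain ⟨k, hk, h⟩ := he.2 f.1 f.2 hfe hmeet
    obtain ⟨h2, hc⟩ := Q.form_eq_neg_cos hfe.symm hmeet (by omega) h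
    rw [hc, angleOrder_neg_cos h2]
    exact even_two_mul k
  · rw [angleOrder_of_le_neg_one (hQ.form_le_neg_one he.1 f.2 hfe hmeet)]
    exact Even.zero

end ConvexPolyhedron

end HypCox

theorem corollary4p2 {n : ℕ} (Q : HypCox.ConvexPolyhedron n) (hQ : Q.IsRedoublable)
    (I : ℕ) (hI : 0 < I) :
    ∃ K : Subgroup Q.coxeterGroup, K.index = I ∧
      ∃ S : Set Q.coxeterGroup,
        (∀ g ∈ S, HypCox.IsReflection (g : Equiv.Perm (HypCox.HypSpace n))) ∧
          K = Subgroup.closure S := by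
  obtain ⟨hC, e, f, he, hf, hne, hmeet⟩ := hQ
  have hne' : (⟨e, he.1⟩ : Q.normals) ≠ ⟨f, hf.1⟩ := fun h => hne (congrArg Subtype.val h)
  let cs := Q.coxeterMatrix.toCoxeterSystem
  let F := cs.lift ⟨_, Q.isLiftable_reflection⟩
  let E : Q.coxeterMatrix.Group ≃* Q.coxeterGroup :=
    (MonoidHom.ofInjective hC.injective_lift).trans
      (MulEquiv.subgroupCongr HypCox.ConvexPolyhedron.range_lift_reflection)
  have hE : ∀ w, (E w : Equiv.Perm (HypCox.HypSpace n)) = F w := fun _ => rfl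
  obtain ⟨K, hK, S, hS, hKS⟩ := cs.exists_index_eq_closure_conj
    (e := ⟨e, he.1⟩) (f := ⟨f, hf.1⟩)
    (by
      rw [Q.coxeterMatrix_of_ne hne']
      exact HypCox.angleOrder_of_le_neg_one (hC.form_le_neg_one he.1 hf.1 hne.symm hmeet))
    (he.even_coxeterMatrix hC) (hf.even_coxeterMatrix hC) hI
  refine ⟨K.map E.toMonoidHom, ?_, E '' S, ?_, ?_⟩
  · rw [← hK]
    exact Subgroup.index_map_equiv K E
  · rintro _ ⟨g, hg, rfl⟩
    obtain ⟨w, i, rfl⟩ := hS g hg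
    have hFi : F (cs.simple i) = HypCox.reflection i.1 :=
      cs.lift_apply_simple Q.isLiftable_reflection i
    rw [hE, map_mul, map_mul, map_inv, hFi]
    exact Q.isReflection_conj (hE w ▸ (E w).2) ⟨i.1, rfl⟩
  · rw [hKS, MonoidHom.map_closure]
    rfl
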